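/- Let $1<p<\infty$ and let $V$ be a real-valued potential on $\mathbb{R}$ satisfying (V1) $V\in L^1_{\mathrm{loc}}(\mathbb{R})\cap C^1(\mathbb{R}\setminus\{0\})$ is even, non-decreasing as a function of $r=|x|>0$, and $V'\not\equiv 0$ on $\mathbb{R}\setminus\{0\}$. Put $X:=\{u\in H^1(\mathbb{R};\mathbb{C}) : V|u|^2\in L^1(\mathbb{R})\}$ and $$\omega_1:=-\inf\Bigl\{\int_{\mathbb{R}}\bigl(|u_x|^2+V|u|^2\bigr)\,dx : u\in X,\ \|u\|_{L^2}=1\Bigr\},$$ and let $\omega>\omega_1$. Then the equation $$-\phi_{xx}+V(x)\phi+\omega\phi-|\phi|^{p-1}\phi=0,\qquad x\in\mathbb{R},$$ has at most one positive solution in $X$: if $\phi,\psi\in X$ are weak solutions (that is, solutions in the sense of distributions) which take real positive values almost everywhere, then $\phi=\psi$ almost everywhere. -/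

import Mathlib

open MeasureTheory

noncomputable section

namespace NLS1D

/-- Condition (V1): `V` is locally integrable on `ℝ`, continuously differentiable on `ℝ \ {0}`,
even, non-decreasing as a function of `r = |x| > 0`, and its derivative does not vanish
identically. The value of `V` at the single point `0` (where `V` may be singular) is irrelevant. -/
structure PotentialCondition (V : ℝ → ℝ) : Prop where
  locallyIntegrable : LocallyIntegrable V volume
  contDiffOn : ContDiffOn ℝ 1 V {0}ᶜ
  even : ∀ x, V (-x) = V x
  monotone : MonotoneOn V (Set.Ioi 0)
  deriv_ne_zero : ∃ x, x ≠ 0 ∧ deriv V x ≠ 0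

/-- Test functions: complex-valued `C^∞` functions with compact support in `ℝ`. -/
def IsTestFunction (η : ℝ → ℂ) : Prop :=
  ContDiff ℝ ((⊤ : ℕ∞) : WithTop ℕ∞) η ∧ HasCompactSupport η

/-- `u'` is a weak (distributional) derivative of `u` on `ℝ`. -/
def HasWeakDeriv (u u' : ℝ → ℂ) : Prop :=
  LocallyIntegrable u volume ∧ LocallyIntegrable u' volume ∧
    ∀ η : ℝ → ℂ, IsTestFunction η → ∫ x, u x * deriv η x = -∫ x, u' x * η x

/-- `u ∈ H¹(ℝ; ℂ)` with weak derivative `u'`. Functions represent their classes modulo almost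
everywhere equality, and `u'` is determined by `u` almost everywhere. -/
def IsH1With (u u' : ℝ → ℂ) : Prop :=
  MemLp u 2 volume ∧ MemLp u' 2 volume ∧ HasWeakDeriv u u'

/-- Membership in `X = {u ∈ H¹(ℝ) : V |u|² ∈ L¹(ℝ)}`. -/
def MemX (V : ℝ → ℝ) (u : ℝ → ℂ) : Prop :=
  (∃ u', IsH1With u u') ∧ Integrable (fun x => V x * ‖u x‖ ^ 2) volume

/-- `ω₁ = - inf {∫ (|u_x|² + V |u|²) : u ∈ X, ‖u‖_{L²} = 1}`. -/
def omegaOne (V : ℝ → ℝ) : ℝ :=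
  -sInf {E : ℝ | ∃ u u' : ℝ → ℂ, IsH1With u u' ∧
    Integrable (fun x => V x * ‖u x‖ ^ 2) volume ∧
    (∫ x, ‖u x‖ ^ 2) = 1 ∧ E = ∫ x, (‖u' x‖ ^ 2 + V x * ‖u x‖ ^ 2)}

/-- `φ ∈ H¹(ℝ)` is a weak solution of `-φ_xx + V φ + ω φ - |φ|^{p-1} φ = 0` on `ℝ`. -/
def IsWeakSolution (V : ℝ → ℝ) (p ω : ℝ) (φ : ℝ → ℂ) : Prop :=
  ∃ φ' : ℝ → ℂ, IsH1With φ φ' ∧ ∀ η : ℝ → ℂ, IsTestFunction η →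
    ∫ x, (φ' x * deriv η x + (V x : ℂ) * φ x * η x + (ω : ℂ) * φ x * η x
      - ((‖φ x‖ ^ (p - 1) : ℝ) : ℂ) * φ x * η x) = 0

/-- `φ` takes real positive values (almost everywhere). -/
def IsPositive (φ : ℝ → ℂ) : Prop :=
  ∀ᵐ x ∂(volume : Measure ℝ), 0 < (φ x).re ∧ (φ x).im = 0

/-- `φ` is a positive solution in `X` of `-φ_xx + V φ + ω φ - |φ|^{p-1} φ = 0`. -/
def IsPositiveSolution (V : ℝ → ℝ) (p ω : ℝ) (φ : ℝ → ℂ) : Prop :=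
  MemX V φ ∧ IsWeakSolution V p ω φ ∧ IsPositive φ

end NLS1D

end

/-! A positive weak solution is represented by a `C¹` profile `u` with `u' = v`, and two profiles
are compared on (0, ∞) by a Sturm-type argument. The energy E = v²/2 - (V+ω)u²/2 + u^(p+1)/(p+1)
satisfies E' = -V'u²/2 ≤ 0 there and is integrable, so it is nonnegative and tends to 0.

For two positive profiles put q = u₁/u₂, W = v₁u₂ - u₁v₂ = u₂²q' and K = E₁ - q²E₂. The potential
cancels from K, and V' cancels from K' = -(q²)'E₂; hence K is continuous across 0 and nondecreasing
while W < 0. Suppose W < 0 just to the right of 0, W(0) ≤ 0 and K(0) ≥ 0. Then W stays negative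
(`wronskian_neg`), so K is nondecreasing from K(0) ≥ 0 with limit 0. This forces K = 0, then E₂ = 0,
then V' = 0 on (0, ∞), which is excluded (`false_of_wronskian_neg`).

Comparing a profile with its reflection yields u'(0) = 0; comparing two profiles then yields u₁(0) =
u₂(0). Uniqueness for the Cauchy problem (`IsProfile.eq_of_eq_at`) concludes. -/

namespace NLS1D

open Set Filter Topology

/-! ### Weak derivatives and primitives on the line. -/

/-- A locally integrable function with vanishing weak derivative is almost everywhere constant. -/
theorem ae_eq_const_of_integral_mul_deriv_eq_zero {h : ℝ → ℝ} (hh : LocallyIntegrable h volume)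
    (H : ∀ η : ℝ → ℝ, ContDiff ℝ (⊤ : ℕ∞) η → HasCompactSupport η → ∫ x, h x * deriv η x = 0) :
    ∃ c : ℝ, ∀ᵐ x ∂(volume : Measure ℝ), h x = c := by
  let χ₀ : ContDiffBump (0 : ℝ) := ⟨1, 2, one_pos, one_lt_two⟩
  set χ : ℝ → ℝ := χ₀.normed volume with hχ
  have χd : ContDiff ℝ (⊤ : ℕ∞) χ := χ₀.contDiff_normed
  have χs : HasCompactSupport χ := χ₀.hasCompactSupport_normed
  have χi : ∫ x, χ x = 1 := χ₀.integral_normed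
  refine ⟨∫ x, h x * χ x, ?_⟩
  set c := ∫ x, h x * χ x with hc
  have key : ∀ᵐ x ∂(volume : Measure ℝ), (fun x => h x - c) x = 0 := by
    refine ae_eq_zero_of_integral_contDiff_smul_eq_zero
      (hh.sub (continuous_const.locallyIntegrable)) fun θ θd θs => ?_
    set m := ∫ x, θ x with hm
    -- Removing the mean of `θ` makes the primitive of `k` compactly supported, hence an admissible
    -- test function.
    set k : ℝ → ℝ := fun x => θ x - m * χ x with hk
    have kd : ContDiff ℝ (⊤ : ℕ∞) k := θd.sub (contDiff_const.mul χd)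
    have ks : HasCompactSupport k := θs.sub (χs.mul_left (f := fun _ => m))
    have ki : ∫ x, k x = 0 := by
      rw [hk, integral_sub (θd.continuous.integrable_of_hasCompactSupport θs)
        ((χd.continuous.integrable_of_hasCompactSupport χs).const_mul m),
        integral_const_mul, χi, mul_one, hm, sub_self]
    obtain ⟨R, hR⟩ := ks.isCompact.isBounded.subset_closedBall 0
    have k0 : ∀ x, R < |x| → k x = 0 := fun x hx => by
      by_contra hne
      have := hR (subset_tsupport k hne)
      rw [Metric.mem_closedBall, dist_zero_right, Real.norm_eq_abs] at this
      linarith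
    have kc : Continuous k := kd.continuous
    set η : ℝ → ℝ := fun x => ∫ t in Iic x, k t with hη
    have kint : Integrable k := kc.integrable_of_hasCompactSupport ks
    have ηder : ∀ x, HasDerivAt η (k x) x := by
      intro x
      have : η = fun x => (∫ t in Iic (0 : ℝ), k t) + ∫ t in (0 : ℝ)..x, k t := by
        funext y
        rw [hη, ← intervalIntegral.integral_Iic_sub_Iic kint.integrableOn kint.integrableOn]
        ring
      rw [this]
      exact (kc.integral_hasStrictDerivAt 0 x).hasDerivAt.const_add _
    have ηd : ContDiff ℝ (⊤ : ℕ∞) η := by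
      rw [contDiff_infty_iff_deriv]
      refine ⟨fun x => (ηder x).differentiableAt, ?_⟩
      rwa [show deriv η = k from funext fun x => (ηder x).deriv]
    have ηs : HasCompactSupport η := by
      refine HasCompactSupport.intro (isCompact_Icc (a := -|R|) (b := |R|)) fun x hx => ?_
      rcases lt_or_ge x (-|R|) with hx' | hx'
      · refine setIntegral_eq_zero_of_forall_eq_zero fun t ht => k0 t ?_
        have : t ≤ x := ht
        exact (le_abs_self R).trans_lt (by linarith [neg_le_abs t, le_abs_self R])
      · have hx2 : |R| < x := by
          by_contra hcon
          exact hx ⟨hx', not_lt.1 hcon⟩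
        rw [hη, ← ki]
        refine setIntegral_eq_integral_of_forall_compl_eq_zero fun t ht => k0 t ?_
        have : x < t := not_le.1 ht
        exact (le_abs_self R).trans_lt (by linarith [le_abs_self t])
    have h0 := H η ηd ηs
    rw [show deriv η = k from funext fun x => (ηder x).deriv] at h0
    have iθ : Integrable (fun x => h x * θ x) := by
      simpa [mul_comm] using
        hh.integrable_smul_left_of_hasCompactSupport θd.continuous θs
    have iχ : Integrable (fun x => h x * χ x) := by
      simpa [mul_comm] using
        hh.integrable_smul_left_of_hasCompactSupport χd.continuous χs
    have e1 : ∫ x, h x * k x = (∫ x, h x * θ x) - m * c := by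
      rw [hc, ← integral_const_mul, ← integral_sub iθ (iχ.const_mul m)]
      congr 1; funext x; simp only [hk]; ring
    have e2 : ∫ x, θ x • (h x - c) = (∫ x, h x * θ x) - m * c := by
      rw [hm, ← integral_mul_const, ← integral_sub iθ
        ((θd.continuous.integrable_of_hasCompactSupport θs).mul_const c)]
      congr 1; funext x; simp only [smul_eq_mul]; ring
    rw [e2, ← e1, h0]
  filter_upwards [key] with x hx
  linarith

/-- The primitive is absolutely continuous with derivative `g` almost everywhere, so integration by
parts applies on an interval containing the support of `η`. -/
theorem integral_primitive_mul_deriv {g η : ℝ → ℝ} (hg : LocallyIntegrable g volume)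
    (ηd : ContDiff ℝ (⊤ : ℕ∞) η) (ηs : HasCompactSupport η) :
    ∫ x, (∫ t in (0 : ℝ)..x, g t) * deriv η x = -∫ x, g x * η x := by
  obtain ⟨R, hR⟩ := ηs.isCompact.isBounded.subset_closedBall 0
  -- The margin 1 puts the support inside the open interval, so the boundary terms vanish.
  set S := |R| + 1 with hS
  have hSpos : 0 < S := by positivity
  have hsub : tsupport η ⊆ Ioo (-S) S := fun x hx => by
    have := hR hx
    rw [Metric.mem_closedBall, dist_zero_right, Real.norm_eq_abs] at this
    have h2 := le_abs_self R
    exact abs_lt.1 (by linarith)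
  have out : ∀ x, x ∉ Ioo (-S) S → η x = 0 := fun x hx =>
    image_eq_zero_of_notMem_tsupport fun h => hx (hsub h)
  have out' : ∀ x, x ∉ Ioo (-S) S → deriv η x = 0 := fun x hx => by
    by_contra hne
    exact hx (hsub (support_deriv_subset hne))
  have restr : ∀ F : ℝ → ℝ, (∀ x, x ∉ Ioo (-S) S → F x = 0) →
      ∫ x, F x = ∫ x in (-S)..S, F x := fun F hF => by
    rw [intervalIntegral.integral_of_le (by linarith)]
    symm
    refine setIntegral_eq_integral_of_forall_compl_eq_zero fun x hx => hF x fun h => hx ⟨h.1, h.2.le⟩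
  have hgi : ∀ a b, IntervalIntegrable g volume a b := fun a b =>
    (hg.integrableOn_isCompact isCompact_uIcc).intervalIntegrable
  have hac : AbsolutelyContinuousOnInterval (fun x => ∫ t in (0 : ℝ)..x, g t) (-S) S :=
    (hgi (-S) S).absolutelyContinuousOnInterval_intervalIntegral
      (by rw [uIcc_of_le (by linarith)]; exact ⟨by linarith, hSpos.le⟩)
  have hac' : AbsolutelyContinuousOnInterval η (-S) S :=
    (ηd.of_le (by simp)).contDiffOn.absolutelyContinuousOnInterval
  rw [restr _ fun x hx => by rw [out' x hx, mul_zero], restr _ fun x hx => by rw [out x hx, mul_zero],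
    hac.integral_mul_deriv_eq_deriv_mul hac', out S (by simp), out (-S) (by simp), mul_zero, mul_zero,
    sub_zero, zero_sub]
  congr 1
  refine intervalIntegral.integral_congr_ae ?_
  filter_upwards [(hgi (-S) S).ae_hasDerivAt_integral] with x hx hmem
  rw [(hx (uIoc_subset_uIcc hmem) 0
    (by rw [uIcc_of_le (by linarith)]; exact ⟨by linarith, hSpos.le⟩)).deriv]

/-- A function with a locally integrable weak derivative is almost everywhere equal to a primitive
of that derivative. -/
theorem exists_ae_eq_primitive {f g : ℝ → ℝ} (hf : LocallyIntegrable f volume)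
    (hg : LocallyIntegrable g volume)
    (H : ∀ η : ℝ → ℝ, ContDiff ℝ (⊤ : ℕ∞) η → HasCompactSupport η →
      ∫ x, f x * deriv η x = -∫ x, g x * η x) :
    ∃ c : ℝ, ∀ᵐ x ∂(volume : Measure ℝ), f x = c + ∫ t in (0 : ℝ)..x, g t := by
  have hGc : Continuous fun x => ∫ t in (0 : ℝ)..x, g t :=
    intervalIntegral.continuous_primitive (fun a b =>
    (hg.integrableOn_isCompact isCompact_uIcc).intervalIntegrable) 0
  obtain ⟨c, hc⟩ := ae_eq_const_of_integral_mul_deriv_eq_zero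
    (hf.sub hGc.locallyIntegrable) fun η ηd ηs => by
      have dd : Continuous (deriv η) := ηd.continuous_deriv (by simp)
      have i1 : Integrable (fun x => f x * deriv η x) := by
        simpa [mul_comm] using hf.integrable_smul_left_of_hasCompactSupport dd ηs.deriv
      have i2 : Integrable (fun x => (∫ t in (0 : ℝ)..x, g t) * deriv η x) :=
        (hGc.mul dd).integrable_of_hasCompactSupport (ηs.deriv.mul_left)
      simp only [Pi.sub_apply, sub_mul]
      rw [integral_sub i1 i2, H η ηd ηs, integral_primitive_mul_deriv hg ηd ηs, sub_self]
  refine ⟨c, ?_⟩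
  filter_upwards [hc] with x hx
  simp only [Pi.sub_apply] at hx
  linarith

/-! ### Regularity: from weak solutions to profiles. -/

/-- A nonnegative bounded `C¹` function `u` of finite energy with absolutely continuous derivative
`v` solving `v' = (V + ω) u - u ^ p`. -/
structure IsProfile (V : ℝ → ℝ) (p ω : ℝ) (u v : ℝ → ℝ) : Prop where
  hasDerivAt : ∀ x, HasDerivAt u (v x) x
  continuous_deriv : Continuous v
  integral_eq : ∀ a b, v b - v a = ∫ t in a..b, ((V t + ω) * u t - u t ^ p)
  nonneg : ∀ x, 0 ≤ u x
  bounded : ∃ M, ∀ x, u x ≤ M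
  integrable_sq : Integrable (fun x => u x ^ 2) volume
  integrable_deriv_sq : Integrable (fun x => v x ^ 2) volume
  integrable_potential : Integrable (fun x => V x * u x ^ 2) volume

theorem locallyIntegrable_re {f : ℝ → ℂ} (hf : LocallyIntegrable f volume) :
    LocallyIntegrable (fun x => (f x).re) volume := fun x => by
  obtain ⟨s, hs, hi⟩ := hf x
  exact ⟨s, hs, Integrable.re hi⟩

theorem isTestFunction_ofReal {η : ℝ → ℝ} (ηd : ContDiff ℝ (⊤ : ℕ∞) η) (ηs : HasCompactSupport η) :
    IsTestFunction (fun x => (η x : ℂ)) :=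
  ⟨Complex.ofRealCLM.contDiff.comp ηd, ηs.comp_left (g := Complex.ofReal) Complex.ofReal_zero⟩

theorem deriv_ofReal_comp {η : ℝ → ℝ} (ηd : ContDiff ℝ (⊤ : ℕ∞) η) (x : ℝ) :
    deriv (fun x : ℝ => (η x : ℂ)) x = ((deriv η x : ℝ) : ℂ) :=
  ((ηd.differentiable (by simp)) x).hasDerivAt.ofReal_comp.deriv

theorem integrable_mul_ofReal {f : ℝ → ℂ} (hf : LocallyIntegrable f volume) {η : ℝ → ℝ}
    (ηc : Continuous η) (ηs : HasCompactSupport η) :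
    Integrable (fun x => f x * (η x : ℂ)) volume := by
  have := hf.integrable_smul_left_of_hasCompactSupport ηc ηs
  refine this.congr (ae_of_all _ fun x => ?_)
  simp [mul_comm]

theorem integral_re_mul_ofReal {f : ℝ → ℂ} (hf : LocallyIntegrable f volume) {η : ℝ → ℝ}
    (ηc : Continuous η) (ηs : HasCompactSupport η) :
    ∫ x, (f x).re * η x = (∫ x, f x * (η x : ℂ)).re := by
  have h := integral_re (integrable_mul_ofReal hf ηc ηs)
  simp only [RCLike.re_eq_complex_re] at h
  rw [← h]
  congr 1; funext x; simp

theorem forall_le_of_ae_le_of_continuous {f g : ℝ → ℝ} (hf : Continuous f) (hg : Continuous g)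
    (h : ∀ᵐ x ∂(volume : Measure ℝ), f x ≤ g x) (x : ℝ) : f x ≤ g x := by
  have hd : Dense {x | f x ≤ g x} := Measure.dense_of_ae h
  have hc : IsClosed {x | f x ≤ g x} := isClosed_le hf hg
  have : x ∈ closure {x | f x ≤ g x} := hd x
  rwa [hc.closure_eq] at this

/-- Integrate (u²)' = 2uv from 0 and use |2uv| ≤ u² + v². -/
theorem exists_bound_of_integrable_sq {u v : ℝ → ℝ} (hu : ∀ x, HasDerivAt u (v x) x)
    (hv : Continuous v) (iu : Integrable (fun x => u x ^ 2) volume)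
    (iv : Integrable (fun x => v x ^ 2) volume) : ∃ M, ∀ x, u x ≤ M := by
  have uc : Continuous u := continuous_iff_continuousAt.2 fun x => (hu x).continuousAt
  set T := ∫ x, (u x ^ 2 + v x ^ 2) with hT
  have key : ∀ x, u x ^ 2 ≤ u 0 ^ 2 + T := fun x => by
    have e : ∫ t in (0 : ℝ)..x, 2 * u t * v t = u x ^ 2 - u 0 ^ 2 := by
      refine intervalIntegral.integral_eq_sub_of_hasDerivAt (f := fun t => u t ^ 2) (fun t _ => ?_)
        ((by fun_prop : Continuous fun t => 2 * u t * v t).intervalIntegrable _ _)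
      simpa using! (hu t).fun_pow 2
    have b : ‖∫ t in (0 : ℝ)..x, 2 * u t * v t‖ ≤ T := by
      refine (intervalIntegral.norm_integral_le_integral_norm_uIoc).trans ?_
      refine (integral_mono_of_nonneg (ae_of_all _ fun t => norm_nonneg _)
        (iu.add iv).integrableOn (ae_of_all _ fun t => ?_)).trans
        (setIntegral_le_integral (iu.add iv) (ae_of_all _ fun t => ?_))
      · simp only [Pi.add_apply, Real.norm_eq_abs]
        exact abs_le.2 ⟨by nlinarith [sq_nonneg (u t + v t)], by nlinarith [sq_nonneg (u t - v t)]⟩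
      · simp only [Pi.add_apply, Pi.zero_apply]; positivity
    rw [e, Real.norm_eq_abs] at b
    linarith [(abs_le.1 b).2]
  exact ⟨Real.sqrt (u 0 ^ 2 + T), fun x => Real.le_sqrt_of_sq_le (key x)⟩

/-- Bootstrap in two steps: `φ` has a continuous representative `u`, so (V+ω)u - u^p is locally
integrable; being the weak derivative of Re `φ'`, it makes that function continuous too, up to a
null set. -/
theorem IsPositiveSolution.exists_isProfile {V : ℝ → ℝ} (hV : PotentialCondition V) {p ω : ℝ}
    (hp : 1 < p) {φ : ℝ → ℂ} (hφ : IsPositiveSolution V p ω φ) :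
    ∃ u v, IsProfile V p ω u v ∧ φ =ᵐ[volume] fun x => (u x : ℂ) := by
  obtain ⟨⟨-, hpot⟩, ⟨φ', ⟨m2, m2', hloc, hloc', hweak⟩, heq⟩, hpos⟩ := hφ
  obtain ⟨c, hc⟩ := exists_ae_eq_primitive (locallyIntegrable_re hloc) (locallyIntegrable_re hloc')
    fun η ηd ηs => by
      rw [integral_re_mul_ofReal hloc (ηd.continuous_deriv (by simp)) ηs.deriv,
        integral_re_mul_ofReal hloc' ηd.continuous ηs, ← Complex.neg_re,
        ← hweak _ (isTestFunction_ofReal ηd ηs)]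
      simp only [deriv_ofReal_comp ηd]
  set u : ℝ → ℝ := fun x => c + ∫ t in (0 : ℝ)..x, (φ' t).re with hu
  have ii : ∀ {h : ℝ → ℝ}, LocallyIntegrable h volume → ∀ a b, IntervalIntegrable h volume a b :=
    fun hh a b => (hh.integrableOn_isCompact isCompact_uIcc).intervalIntegrable
  have uc : Continuous u :=
    continuous_const.add (intervalIntegral.continuous_primitive (ii (locallyIntegrable_re hloc')) 0)
  have φu : ∀ᵐ x ∂(volume : Measure ℝ), φ x = (u x : ℂ) ∧ 0 < u x := by
    filter_upwards [hc, hpos] with x h1 h2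
    have h3 : (φ x).re = u x := h1
    exact ⟨Complex.ext (by simpa using h3) (by simpa using h2.2), h3 ▸ h2.1⟩
  have unn : ∀ x, 0 ≤ u x := forall_le_of_ae_le_of_continuous continuous_const uc
    (φu.mono fun x hx => hx.2.le)
  set F : ℝ → ℝ := fun x => (V x + ω) * u x - u x ^ p with hF
  have upc : Continuous fun x => u x ^ p := uc.rpow_const fun x => Or.inr (by linarith)
  have Floc : LocallyIntegrable F volume := by
    have h1 : LocallyIntegrable (fun x => (V x + ω) * u x) volume := by
      have := (hV.locallyIntegrable.add (continuous_const (y := ω)).locallyIntegrable)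
      rw [locallyIntegrable_iff] at this ⊢
      intro k hk
      exact (this k hk).mul_continuousOn uc.continuousOn hk
    exact h1.sub upc.locallyIntegrable
  obtain ⟨d, hd⟩ := exists_ae_eq_primitive (locallyIntegrable_re hloc') Floc fun η ηd ηs => by
    have dc : Continuous (deriv η) := ηd.continuous_deriv (by simp)
    have h := heq _ (isTestFunction_ofReal ηd ηs)
    have iF : Integrable (fun x => F x * η x) volume := by
      simpa [mul_comm] using Floc.integrable_smul_left_of_hasCompactSupport ηd.continuous ηs
    have i1 := integrable_mul_ofReal hloc' dc ηs.deriv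
    have e : ∫ x, (φ' x * ((deriv η x : ℝ) : ℂ) + ((F x * η x : ℝ) : ℂ)) = 0 := by
      rw [← h]
      refine integral_congr_ae ?_
      filter_upwards [φu] with x hx
      rw [deriv_ofReal_comp ηd, hx.1, Complex.norm_real, Real.norm_of_nonneg hx.2.le]
      have : u x ^ p = u x ^ (p - 1) * u x := by
        rw [← Real.rpow_add_one hx.2.ne', sub_add_cancel]
      simp only [hF, this]
      push_cast
      ring
    rw [integral_add i1 (show Integrable (fun x => ((F x * η x : ℝ) : ℂ)) volume from iF.ofReal),
      integral_complex_ofReal] at e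
    rw [integral_re_mul_ofReal hloc' dc ηs.deriv, eq_neg_of_add_eq_zero_left e]
    simp
  set v : ℝ → ℝ := fun x => d + ∫ t in (0 : ℝ)..x, F t with hv
  have vc : Continuous v :=
    continuous_const.add (intervalIntegral.continuous_primitive (ii Floc) 0)
  have uv : u = fun x => c + ∫ t in (0 : ℝ)..x, v t := by
    funext x
    simp only [hu]
    congr 1
    exact intervalIntegral.integral_congr_ae (hd.mono fun t ht _ => ht)
  have hder : ∀ x, HasDerivAt u (v x) x := fun x => by
    rw [uv]
    exact (vc.integral_hasStrictDerivAt 0 x).hasDerivAt.const_add _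
  have iu : Integrable (fun x => u x ^ 2) volume := by
    refine ((memLp_two_iff_integrable_sq_norm m2.1).1 m2).congr ?_
    filter_upwards [φu] with x hx
    rw [hx.1, Complex.norm_real, Real.norm_eq_abs, sq_abs]
  have iv : Integrable (fun x => v x ^ 2) volume := by
    have m := m2'.re
    refine ((memLp_two_iff_integrable_sq m.1).1 m).congr ?_
    filter_upwards [hd] with x hx
    rw [RCLike.re_eq_complex_re, hx]
  refine ⟨u, v, ⟨hder, vc, fun a b => ?_, unn, exists_bound_of_integrable_sq hder vc iu iv, iu, iv,
    ?_⟩, φu.mono fun x hx => hx.1⟩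
  · rw [← intervalIntegral.integral_interval_sub_left (ii Floc 0 b) (ii Floc 0 a)]
    simp only [hv]
    ring
  · refine hpot.congr ?_
    filter_upwards [φu] with x hx
    rw [hx.1, Complex.norm_real, Real.norm_eq_abs, sq_abs]

/-! ### Reflection, Cauchy uniqueness and strict positivity. -/

theorem isProfile_zero (V : ℝ → ℝ) {p : ℝ} (hp : p ≠ 0) (ω : ℝ) : IsProfile V p ω 0 0 where
  hasDerivAt x := hasDerivAt_const x 0
  continuous_deriv := continuous_const
  integral_eq a b := by simp [Real.zero_rpow hp]
  nonneg x := le_rfl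
  bounded := ⟨0, fun x => le_rfl⟩
  integrable_sq := by simp
  integrable_deriv_sq := by simp
  integrable_potential := by simp

theorem IsProfile.reflect {V : ℝ → ℝ} (hV : ∀ x, V (-x) = V x) {p ω : ℝ} {u v : ℝ → ℝ}
    (h : IsProfile V p ω u v) : IsProfile V p ω (fun x => u (-x)) (fun x => -v (-x)) where
  hasDerivAt x := by
    simpa using! (h.hasDerivAt (-x)).comp x (hasDerivAt_neg x)
  continuous_deriv := (h.continuous_deriv.comp continuous_neg).neg
  integral_eq a b := by
    have := intervalIntegral.integral_comp_neg (a := a) (b := b)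
      (fun t => (V t + ω) * u t - u t ^ p)
    simp only [hV] at this
    rw [this, ← h.integral_eq]
    ring
  nonneg x := h.nonneg _
  bounded := h.bounded.imp fun M hM x => hM _
  integrable_sq := h.integrable_sq.comp_neg
  integrable_deriv_sq := by simpa using h.integrable_deriv_sq.comp_neg
  integrable_potential := by simpa [hV] using h.integrable_potential.comp_neg

theorem abs_rpow_sub_rpow_le {p M s t : ℝ} (hp : 1 < p) (hs : s ∈ Icc 0 M) (ht : t ∈ Icc 0 M) :
    |s ^ p - t ^ p| ≤ p * M ^ (p - 1) * |s - t| := by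
  refine (convex_Icc 0 M).norm_image_sub_le_of_norm_hasDerivWithin_le (f := fun r => r ^ p)
    (fun r _ => (Real.hasDerivAt_rpow_const (Or.inr hp.le)).hasDerivWithinAt) (fun r hr => ?_) ht hs
  rw [Real.norm_of_nonneg (mul_nonneg (by linarith) (Real.rpow_nonneg hr.1 _))]
  exact mul_le_mul_of_nonneg_left (Real.rpow_le_rpow hr.1 hr.2 (by linarith)) (by linarith)

/-- Two functions with the same second order data at `a` whose second derivatives differ by at most
a locally integrable multiple of the difference agree near `a`. -/
theorem eventually_eq_zero_of_abs_le_mul {z y h k : ℝ → ℝ} {a : ℝ}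
    (hz : ∀ x, HasDerivAt z (y x) x) (hy : ∀ x, y x = ∫ t in a..x, h t)
    (hk : LocallyIntegrable k volume) (hk0 : ∀ x, 0 ≤ k x) (hh : ∀ x, |h x| ≤ k x * |z x|)
    (ha : z a = 0) : ∀ᶠ x in 𝓝 a, z x = 0 ∧ y x = 0 := by
  have ki : ∀ a b, IntervalIntegrable k volume a b := fun a b =>
    (hk.integrableOn_isCompact isCompact_uIcc).intervalIntegrable
  have zc : Continuous z := continuous_iff_continuousAt.2 fun x => (hz x).continuousAt
  have Gc : Continuous fun x => ∫ t in a..x, k t := intervalIntegral.continuous_primitive ki a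
  have ev : ∀ᶠ x in 𝓝 a, |∫ t in a..x, k t| < 1 / 2 :=
    Gc.abs.continuousAt.eventually_lt continuousAt_const (by simp)
  obtain ⟨ε, hε, hball⟩ := Metric.eventually_nhds_iff.1 ev
  -- On this interval the integral of `k` from `a` is below 1/2 and lengths from `a` are at most 1.
  -- Hence |y| ≤ m/2, then |z| ≤ m/2, so the maximum `m` of |z| is 0.
  set δ := min (ε / 2) 1 with hδ
  have δ0 : 0 < δ := by positivity
  have δ1 : δ ≤ 1 := min_le_right _ _
  have δε : δ < ε := (min_le_left _ _).trans_lt (by linarith)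
  set I := Icc (a - δ) (a + δ) with hI
  have aI : a ∈ I := ⟨by linarith, by linarith⟩
  obtain ⟨x₀, hx₀, hmax⟩ := isCompact_Icc.exists_isMaxOn ⟨a, aI⟩ zc.abs.continuousOn
  set m := |z x₀| with hm
  have m0 : 0 ≤ m := abs_nonneg _
  have zm : ∀ x ∈ I, |z x| ≤ m := fun x hx => hmax hx
  have ym : ∀ x ∈ I, |y x| ≤ m / 2 := fun x hx => by
    have h1 : ‖∫ t in a..x, h t‖ ≤ |∫ t in a..x, k t * m| := by
      refine intervalIntegral.norm_integral_le_abs_of_norm_le ?_ ((ki a x).mul_const m)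
      refine (ae_restrict_mem measurableSet_uIoc).mono fun t ht => (hh t).trans ?_
      exact mul_le_mul_of_nonneg_left
        (zm t (ordConnected_Icc.uIcc_subset aI hx (uIoc_subset_uIcc ht))) (hk0 t)
    rw [intervalIntegral.integral_mul_const, abs_mul, abs_of_nonneg m0, ← hy,
      Real.norm_eq_abs] at h1
    have h2 : |∫ t in a..x, k t| < 1 / 2 := hball (by
      rw [Real.dist_eq]
      exact (abs_le.2 ⟨by linarith [hx.1], by linarith [hx.2]⟩).trans_lt δε)
    nlinarith
  have hm0 : m = 0 := by
    have h1 := (convex_Icc (a - δ) (a + δ)).norm_image_sub_le_of_norm_hasDerivWithin_le (f := z)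
      (fun r _ => (hz r).hasDerivWithinAt) (fun r hr => ym r hr) aI hx₀
    rw [ha, sub_zero, Real.norm_eq_abs, Real.norm_eq_abs] at h1
    have h2 : |x₀ - a| ≤ 1 := (abs_le.2 ⟨by linarith [hx₀.1], by linarith [hx₀.2]⟩).trans δ1
    nlinarith
  filter_upwards [Icc_mem_nhds (by linarith : a - δ < a) (by linarith : a < a + δ)] with x hx
  exact ⟨abs_nonpos_iff.1 (hm0 ▸ zm x hx), abs_nonpos_iff.1 (by linarith [ym x hx])⟩

theorem IsProfile.continuous {V : ℝ → ℝ} {p ω : ℝ} {u v : ℝ → ℝ} (h : IsProfile V p ω u v) :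
    Continuous u := continuous_iff_continuousAt.2 fun x => (h.hasDerivAt x).continuousAt

theorem IsProfile.intervalIntegrable {V : ℝ → ℝ} (hV : LocallyIntegrable V volume) {p ω : ℝ}
    (hp : 1 < p) {u v : ℝ → ℝ} (h : IsProfile V p ω u v) (a b : ℝ) :
    IntervalIntegrable (fun t => (V t + ω) * u t - u t ^ p) volume a b := by
  have h1 : IntervalIntegrable (fun t => V t + ω) volume a b :=
    (hV.integrableOn_isCompact isCompact_uIcc).intervalIntegrable.add intervalIntegrable_const
  exact (h1.mul_continuousOn h.continuous.continuousOn).sub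
    ((h.continuous.rpow_const fun x => Or.inr (by linarith)).intervalIntegrable a b)

/-- Profiles with the same Cauchy data at a point coincide. -/
theorem IsProfile.eq_of_eq_at {V : ℝ → ℝ} (hV : LocallyIntegrable V volume) {p ω : ℝ} (hp : 1 < p)
    {u₁ v₁ u₂ v₂ : ℝ → ℝ} (h₁ : IsProfile V p ω u₁ v₁) (h₂ : IsProfile V p ω u₂ v₂) {a : ℝ}
    (hu : u₁ a = u₂ a) (hv : v₁ a = v₂ a) : u₁ = u₂ := by
  obtain ⟨M₁, hM₁⟩ := h₁.bounded
  obtain ⟨M₂, hM₂⟩ := h₂.bounded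
  set M := max M₁ M₂
  set L := p * M ^ (p - 1)
  have hM0 : 0 ≤ M := (h₁.nonneg 0).trans ((hM₁ 0).trans (le_max_left _ _))
  have L0 : 0 ≤ L := mul_nonneg (by linarith) (Real.rpow_nonneg hM0 _)
  set z := fun x => u₁ x - u₂ x with hz
  set y := fun x => v₁ x - v₂ x with hy
  set k := fun x => |V x + ω| + L with hk
  have zc : Continuous z := h₁.continuous.sub h₂.continuous
  have yc : Continuous y := h₁.continuous_deriv.sub h₂.continuous_deriv
  have kl : LocallyIntegrable k volume := fun x => by
    have h3 : LocallyIntegrable (fun x => V x + ω) volume :=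
      hV.add (continuous_const (y := ω)).locallyIntegrable
    obtain ⟨s, hs, hi⟩ := h3 x
    obtain ⟨s', hs', hi'⟩ := (continuous_const (y := L)).locallyIntegrable (μ := volume) x
    exact ⟨s ∩ s', inter_mem hs hs',
      (IntegrableOn.mono_set hi.abs inter_subset_left).add (hi'.mono_set inter_subset_right)⟩
  -- The coincidence set of the Cauchy data is closed by continuity and open by the local result.
  set S := {x | z x = 0 ∧ y x = 0} with hS
  have hcl : IsClosed S :=
    (isClosed_eq zc continuous_const).inter (isClosed_eq yc continuous_const)
  have hop : IsOpen S := isOpen_iff_mem_nhds.2 fun b hb => by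
    refine eventually_eq_zero_of_abs_le_mul (k := k)
      (h := fun t => ((V t + ω) * u₁ t - u₁ t ^ p) - ((V t + ω) * u₂ t - u₂ t ^ p))
      (fun x => (h₁.hasDerivAt x).sub (h₂.hasDerivAt x)) (fun x => ?_) kl
      (fun x => by positivity) (fun x => ?_) hb.1
    · rw [intervalIntegral.integral_sub (h₁.intervalIntegrable hV hp _ _)
        (h₂.intervalIntegrable hV hp _ _), ← h₁.integral_eq, ← h₂.integral_eq]
      have := hb.2
      simp only [hy] at this ⊢
      linarith
    · have e : ((V x + ω) * u₁ x - u₁ x ^ p) - ((V x + ω) * u₂ x - u₂ x ^ p)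
          = (V x + ω) * (u₁ x - u₂ x) - (u₁ x ^ p - u₂ x ^ p) := by ring
      rw [e]
      refine (abs_sub _ _).trans ?_
      rw [abs_mul, hk, add_mul]
      gcongr
      exact abs_rpow_sub_rpow_le hp ⟨h₁.nonneg x, (hM₁ x).trans (le_max_left _ _)⟩
        ⟨h₂.nonneg x, (hM₂ x).trans (le_max_right _ _)⟩
  have hun : S = univ := IsClopen.eq_univ ⟨hcl, hop⟩
    ⟨a, sub_eq_zero.2 hu, sub_eq_zero.2 hv⟩
  funext x
  have : x ∈ S := hun ▸ mem_univ x
  exact sub_eq_zero.1 this.1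

/-- A zero of `u` is a minimum, so `v` vanishes there too and `u` coincides with the zero profile.
-/
theorem IsProfile.pos {V : ℝ → ℝ} (hV : LocallyIntegrable V volume) {p ω : ℝ} (hp : 1 < p)
    {u v : ℝ → ℝ} (h : IsProfile V p ω u v) (hne : u ≠ 0) (x : ℝ) : 0 < u x := by
  refine lt_of_le_of_ne (h.nonneg x) fun h0 => hne ?_
  have hmin : IsLocalMin u x := Eventually.of_forall fun t => h0 ▸ h.nonneg t
  exact h.eq_of_eq_at hV hp (isProfile_zero V (by linarith) ω) h0.symm
    (hmin.hasDerivAt_eq_zero (h.hasDerivAt x))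

/-! ### The pointwise energy: monotonicity and decay. -/

theorem PotentialCondition.hasDerivAt {V : ℝ → ℝ} (hV : PotentialCondition V) {x : ℝ}
    (hx : x ≠ 0) : HasDerivAt V (deriv V x) x :=
  ((hV.contDiffOn.differentiableOn (by simp)).differentiableAt
    (isOpen_compl_singleton.mem_nhds hx)).hasDerivAt

theorem PotentialCondition.deriv_nonneg {V : ℝ → ℝ} (hV : PotentialCondition V) {x : ℝ}
    (hx : 0 < x) : 0 ≤ deriv V x := by
  rw [← derivWithin_of_isOpen isOpen_Ioi hx]
  exact hV.monotone.derivWithin_nonneg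

theorem PotentialCondition.exists_pos_deriv_ne_zero {V : ℝ → ℝ} (hV : PotentialCondition V) :
    ∃ x, 0 < x ∧ deriv V x ≠ 0 := by
  obtain ⟨x, hx, hd⟩ := hV.deriv_ne_zero
  rcases hx.lt_or_gt with h | h
  · refine ⟨-x, by linarith, ?_⟩
    have := deriv_comp_neg V x
    simp only [hV.even] at this
    intro h0
    rw [h0, neg_zero] at this
    exact hd this
  · exact ⟨x, h, hd⟩

theorem IsProfile.hasDerivAt_deriv {V : ℝ → ℝ} (hV : PotentialCondition V) {p ω : ℝ} (hp : 1 < p)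
    {u v : ℝ → ℝ} (h : IsProfile V p ω u v) {x : ℝ} (hx : x ≠ 0) :
    HasDerivAt v ((V x + ω) * u x - u x ^ p) x := by
  have hv : v = fun y => v x + ∫ t in x..y, ((V t + ω) * u t - u t ^ p) := by
    funext y
    rw [← h.integral_eq]
    ring
  have hc : ContinuousOn (fun t => (V t + ω) * u t - u t ^ p) {0}ᶜ :=
    ((hV.contDiffOn.continuousOn.add continuousOn_const).mul h.continuous.continuousOn).sub
      (h.continuous.rpow_const fun x => Or.inr (by linarith)).continuousOn
  rw [hv]
  exact (intervalIntegral.integral_hasDerivAt_right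
    (h.intervalIntegrable hV.locallyIntegrable hp x x)
    (hc.stronglyMeasurableAtFilter isOpen_compl_singleton x hx)
    (hc.continuousAt (isOpen_compl_singleton.mem_nhds hx))).const_add _

/-- The pointwise energy of a profile. -/
noncomputable def energy (V : ℝ → ℝ) (p ω : ℝ) (u v : ℝ → ℝ) (x : ℝ) : ℝ :=
  v x ^ 2 / 2 - (V x + ω) * u x ^ 2 / 2 + u x ^ (p + 1) / (p + 1)

theorem IsProfile.hasDerivAt_energy {V : ℝ → ℝ} (hV : PotentialCondition V) {p ω : ℝ} (hp : 1 < p)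
    {u v : ℝ → ℝ} (h : IsProfile V p ω u v) {x : ℝ} (hx : x ≠ 0) :
    HasDerivAt (energy V p ω u v) (-(deriv V x * u x ^ 2 / 2)) x := by
  have h1 := ((h.hasDerivAt_deriv hV hp hx).fun_pow 2).div_const 2
  have h2 := (((hV.hasDerivAt hx).add_const ω).fun_mul ((h.hasDerivAt x).fun_pow 2)).div_const 2
  have h3 := ((h.hasDerivAt x).rpow_const (p := p + 1) (Or.inr (by linarith))).div_const (p + 1)
  refine ((h1.sub h2).add h3).congr_deriv ?_
  have : p + 1 ≠ 0 := by linarith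
  rw [add_sub_cancel_right]
  field_simp
  ring

theorem IsProfile.antitoneOn_energy {V : ℝ → ℝ} (hV : PotentialCondition V) {p ω : ℝ} (hp : 1 < p)
    {u v : ℝ → ℝ} (h : IsProfile V p ω u v) : AntitoneOn (energy V p ω u v) (Ioi 0) := by
  have hd : ∀ x ∈ Ioi (0 : ℝ), HasDerivAt (energy V p ω u v) (-(deriv V x * u x ^ 2 / 2)) x :=
    fun x hx => h.hasDerivAt_energy hV hp (ne_of_gt hx)
  refine antitoneOn_of_deriv_nonpos (convex_Ioi 0)
    (fun x hx => (hd x hx).continuousAt.continuousWithinAt)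
    (fun x hx => (hd x (interior_subset hx)).differentiableAt.differentiableWithinAt)
    fun x hx => ?_
  rw [(hd x (interior_subset hx)).deriv]
  have := hV.deriv_nonneg (interior_subset hx : x ∈ Ioi 0)
  have := mul_nonneg this (sq_nonneg (u x))
  linarith

/-- Boundedness of `u` controls the nonlinear term: u^(p+1) ≤ M^(p-1) u². -/
theorem IsProfile.integrable_energy {V : ℝ → ℝ} {p ω : ℝ} (hp : 1 < p)
    {u v : ℝ → ℝ} (h : IsProfile V p ω u v) : Integrable (energy V p ω u v) volume := by
  obtain ⟨M, hM⟩ := h.bounded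
  have h1 : Integrable (fun x => u x ^ (p + 1)) volume := by
    refine (h.integrable_sq.const_mul (M ^ (p - 1))).mono'
      (h.continuous.rpow_const fun x => Or.inr (by linarith)).aestronglyMeasurable
      (ae_of_all _ fun x => ?_)
    have e : u x ^ (p + 1) = u x ^ (p - 1) * u x ^ 2 := by
      rw [← Real.rpow_natCast (u x) 2, ← Real.rpow_add' (h.nonneg x)]
      · congr 1; push_cast; ring
      · push_cast; linarith
    rw [e, Real.norm_of_nonneg (mul_nonneg (Real.rpow_nonneg (h.nonneg x) _) (sq_nonneg _))]
    exact mul_le_mul_of_nonneg_right (Real.rpow_le_rpow (h.nonneg x) (hM x) (by linarith))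
      (sq_nonneg _)
  refine ((((h.integrable_deriv_sq.div_const 2).sub
    ((h.integrable_potential.add (h.integrable_sq.const_mul ω)).div_const 2)).add
    (h1.div_const (p + 1)))).congr (ae_of_all _ fun x => ?_)
  simp only [energy, Pi.add_apply, Pi.sub_apply]
  ring

theorem exists_abs_lt_of_integrable {J : ℝ → ℝ} (hJ : Integrable J volume) {c : ℝ} (hc : 0 < c)
    (a : ℝ) : ∃ x, a < x ∧ |J x| < c := by
  by_contra! H
  have h1 : IntegrableOn (fun _ : ℝ => c) (Ioi a) volume :=
    hJ.abs.integrableOn.mono' aestronglyMeasurable_const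
      ((ae_restrict_mem measurableSet_Ioi).mono fun x hx => by
        rw [Real.norm_of_nonneg hc.le]; exact H x hx)
  rw [integrableOn_const_iff] at h1
  rcases h1 with h | h
  · exact hc.ne' (by simpa using h)
  · simp at h

theorem nonneg_of_antitoneOn_of_integrable {J : ℝ → ℝ} (ha : AntitoneOn J (Ioi 0))
    (hJ : Integrable J volume) {x : ℝ} (hx : 0 < x) : 0 ≤ J x := by
  by_contra! H
  obtain ⟨y, hy, hyJ⟩ := exists_abs_lt_of_integrable hJ (neg_pos.2 H) x
  have h1 := ha hx (hx.trans hy) hy.le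
  have := (abs_lt.1 hyJ).1
  linarith

theorem tendsto_zero_of_antitoneOn_of_integrable {J : ℝ → ℝ} (ha : AntitoneOn J (Ioi 0))
    (hJ : Integrable J volume) : Tendsto J atTop (𝓝 0) := by
  refine Metric.tendsto_atTop.2 fun ε hε => ?_
  obtain ⟨y, hy, hyJ⟩ := exists_abs_lt_of_integrable hJ hε 0
  refine ⟨y, fun x hx => ?_⟩
  have h1 := ha hy (hy.trans_le hx) hx
  have h2 := nonneg_of_antitoneOn_of_integrable ha hJ (hy.trans_le hx)
  rw [Real.dist_eq, sub_zero, abs_of_nonneg h2]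
  exact h1.trans_lt (abs_lt.1 hyJ).2

/-! ### Comparison of two positive profiles. -/

/-- The Wronskian of two profiles. -/
noncomputable def wronskian (u₁ v₁ u₂ v₂ : ℝ → ℝ) (x : ℝ) : ℝ := v₁ x * u₂ x - u₁ x * v₂ x

/-- The difference of the energies of two profiles, the second one weighted by the square of the
quotient of the profiles. -/
noncomputable def relativeEnergy (V : ℝ → ℝ) (p ω : ℝ) (u₁ v₁ u₂ v₂ : ℝ → ℝ) (x : ℝ) : ℝ :=
  energy V p ω u₁ v₁ x - (u₁ x / u₂ x) ^ 2 * energy V p ω u₂ v₂ x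

section Pair

variable {V : ℝ → ℝ} {p ω : ℝ} {u₁ v₁ u₂ v₂ : ℝ → ℝ}

/-- The terms in V + ω cancel. The formula therefore also holds at 0, whatever the value of `V`
there, and yields continuity across a singularity. -/
theorem relativeEnergy_eq {x : ℝ} (hp : 1 < p) (p₁ : 0 < u₁ x) (p₂ : 0 < u₂ x) :
    relativeEnergy V p ω u₁ v₁ u₂ v₂ x = (v₁ x ^ 2 - (u₁ x / u₂ x) ^ 2 * v₂ x ^ 2) / 2
      + u₁ x ^ 2 * (u₁ x ^ (p - 1) - u₂ x ^ (p - 1)) / (p + 1) := by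
  have e : ∀ t : ℝ, 0 < t → t ^ (p + 1) = t ^ (p - 1) * t ^ 2 := fun t ht => by
    rw [← Real.rpow_natCast t 2, ← Real.rpow_add ht]
    congr 1; push_cast; ring
  have h0 : p + 1 ≠ 0 := by linarith
  have h2 := p₂.ne'
  simp only [relativeEnergy, energy, e _ p₁, e _ p₂]
  field_simp
  ring

theorem hasDerivAt_quotient (h₁ : IsProfile V p ω u₁ v₁) (h₂ : IsProfile V p ω u₂ v₂) {x : ℝ}
    (p₂ : 0 < u₂ x) :
    HasDerivAt (fun x => u₁ x / u₂ x) (wronskian u₁ v₁ u₂ v₂ x / u₂ x ^ 2) x :=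
  (h₁.hasDerivAt x).fun_div (h₂.hasDerivAt x) p₂.ne'

theorem hasDerivAt_wronskian (hV : PotentialCondition V) (hp : 1 < p)
    (h₁ : IsProfile V p ω u₁ v₁) (h₂ : IsProfile V p ω u₂ v₂) {x : ℝ}
    (p₁ : 0 < u₁ x) (p₂ : 0 < u₂ x) (hx : x ≠ 0) :
    HasDerivAt (wronskian u₁ v₁ u₂ v₂)
      (u₁ x * u₂ x * (u₂ x ^ (p - 1) - u₁ x ^ (p - 1))) x := by
  refine (((h₁.hasDerivAt_deriv hV hp hx).fun_mul (h₂.hasDerivAt x)).sub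
    ((h₁.hasDerivAt x).fun_mul (h₂.hasDerivAt_deriv hV hp hx))).congr_deriv ?_
  have e : ∀ t : ℝ, 0 < t → t ^ p = t ^ (p - 1) * t := fun t ht => by
    rw [← Real.rpow_add_one ht.ne', sub_add_cancel]
  rw [e _ p₁, e _ p₂]
  ring

/-- The weight (u₁/u₂)² turns the loss V'u₂²/2 of the second energy into V'u₁²/2, that of the first,
so only the derivative of the weight survives. -/
theorem hasDerivAt_relativeEnergy (hV : PotentialCondition V) (hp : 1 < p)
    (h₁ : IsProfile V p ω u₁ v₁) (h₂ : IsProfile V p ω u₂ v₂) {x : ℝ} (p₂ : 0 < u₂ x)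
    (hx : x ≠ 0) :
    HasDerivAt (relativeEnergy V p ω u₁ v₁ u₂ v₂)
      (-(2 * (u₁ x / u₂ x) * (wronskian u₁ v₁ u₂ v₂ x / u₂ x ^ 2) * energy V p ω u₂ v₂ x)) x := by
  refine ((h₁.hasDerivAt_energy hV hp hx).sub
    (((hasDerivAt_quotient h₁ h₂ p₂).fun_pow 2).fun_mul
      (h₂.hasDerivAt_energy hV hp hx))).congr_deriv ?_
  have h2 := p₂.ne'
  simp only [Nat.cast_ofNat, Nat.add_one_sub_one, pow_one]
  field_simp
  ring

theorem continuous_relativeEnergy (hp : 1 < p) (h₁ : IsProfile V p ω u₁ v₁)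
    (h₂ : IsProfile V p ω u₂ v₂) (p₁ : ∀ x, 0 < u₁ x) (p₂ : ∀ x, 0 < u₂ x) :
    Continuous (relativeEnergy V p ω u₁ v₁ u₂ v₂) := by
  rw [show relativeEnergy V p ω u₁ v₁ u₂ v₂ = _ from
    funext fun x => relativeEnergy_eq hp (p₁ x) (p₂ x)]
  have c1 := h₁.continuous
  have c2 := h₂.continuous
  have c3 := h₁.continuous_deriv
  have c4 := h₂.continuous_deriv
  have r1 := c1.rpow_const (p := p - 1) fun x => Or.inr (by linarith)
  have r2 := c2.rpow_const (p := p - 1) fun x => Or.inr (by linarith)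
  have q := c1.div c2 fun x => (p₂ x).ne'
  exact (((c3.pow 2).sub ((q.pow 2).mul (c4.pow 2))).div_const 2).add
    (((c1.pow 2).mul (r1.sub r2)).div_const (p + 1))

/-- While the Wronskian is negative, the quotient of the profiles is strictly decreasing. -/
theorem strictAntiOn_quotient (h₁ : IsProfile V p ω u₁ v₁) (h₂ : IsProfile V p ω u₂ v₂)
    (p₂ : ∀ x, 0 < u₂ x) {D : Set ℝ} (hD : Convex ℝ D)
    (hW : ∀ x ∈ interior D, wronskian u₁ v₁ u₂ v₂ x < 0) :
    StrictAntiOn (fun x => u₁ x / u₂ x) D := by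
  refine strictAntiOn_of_deriv_neg hD
    (fun x _ => (hasDerivAt_quotient h₁ h₂ (p₂ x)).continuousAt.continuousWithinAt) fun x hx => ?_
  rw [(hasDerivAt_quotient h₁ h₂ (p₂ x)).deriv]
  exact div_neg_of_neg_of_pos (hW x hx) (pow_pos (p₂ x) 2)

/-- While the Wronskian is negative, the relative energy is nondecreasing. -/
theorem monotoneOn_relativeEnergy (hV : PotentialCondition V) (hp : 1 < p)
    (h₁ : IsProfile V p ω u₁ v₁) (h₂ : IsProfile V p ω u₂ v₂) (p₁ : ∀ x, 0 < u₁ x)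
    (p₂ : ∀ x, 0 < u₂ x) {D : Set ℝ} (hD : Convex ℝ D) (hpos : interior D ⊆ Ioi 0)
    (hW : ∀ x ∈ interior D, wronskian u₁ v₁ u₂ v₂ x < 0) :
    MonotoneOn (relativeEnergy V p ω u₁ v₁ u₂ v₂) D := by
  have hd := fun x (hx : x ∈ interior D) =>
    hasDerivAt_relativeEnergy hV hp h₁ h₂ (p₂ x) (ne_of_gt (hpos hx))
  refine monotoneOn_of_deriv_nonneg hD (continuous_relativeEnergy hp h₁ h₂ p₁ p₂).continuousOn
    (fun x hx => (hd x hx).differentiableAt.differentiableWithinAt) fun x hx => ?_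
  rw [(hd x hx).deriv]
  have h3 := nonneg_of_antitoneOn_of_integrable (h₂.antitoneOn_energy hV hp)
    (h₂.integrable_energy hp) (hpos hx)
  have h4 : wronskian u₁ v₁ u₂ v₂ x / u₂ x ^ 2 ≤ 0 :=
    div_nonpos_of_nonpos_of_nonneg (hW x hx).le (sq_nonneg _)
  have h5 : 0 ≤ 2 * (u₁ x / u₂ x) := by have := div_pos (p₁ x) (p₂ x); positivity
  have := mul_nonneg (mul_nonneg h5 (neg_nonneg.2 h4)) h3
  linarith

/-- If the Wronskian is negative near `0⁺` and the relative energy is nonnegative at `0`, then the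
Wronskian is negative on `(0, ∞)`. -/
theorem wronskian_neg (hV : PotentialCondition V) (hp : 1 < p)
    (h₁ : IsProfile V p ω u₁ v₁) (h₂ : IsProfile V p ω u₂ v₂) (p₁ : ∀ x, 0 < u₁ x)
    (p₂ : ∀ x, 0 < u₂ x) (hW0 : wronskian u₁ v₁ u₂ v₂ 0 ≤ 0)
    (hK0 : 0 ≤ relativeEnergy V p ω u₁ v₁ u₂ v₂ 0)
    (hW : ∀ᶠ x in 𝓝[>] 0, wronskian u₁ v₁ u₂ v₂ x < 0) {x : ℝ} (hx : 0 < x) :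
    wronskian u₁ v₁ u₂ v₂ x < 0 := by
  have Wc : Continuous (wronskian u₁ v₁ u₂ v₂) :=
    (h₁.continuous_deriv.mul h₂.continuous).sub (h₁.continuous.mul h₂.continuous_deriv)
  by_contra! hxW
  obtain ⟨ε, hε, hεW⟩ := mem_nhdsGT_iff_exists_Ioo_subset.1 hW
  have hε : 0 < ε := hε
  -- The left end lies where the Wronskian is known to be negative, so the least element `b` of this
  -- compact set is its first zero in (0, ∞).
  set S := Icc (min ε x / 2) x ∩ {t | 0 ≤ wronskian u₁ v₁ u₂ v₂ t} with hS
  have hm : 0 < min ε x := lt_min hε hx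
  have Sc : IsCompact S := isCompact_Icc.inter_right (isClosed_le continuous_const Wc)
  obtain ⟨b, ⟨⟨hb1, hb2⟩, hb3⟩, hbmin⟩ := Sc.exists_isLeast
    ⟨x, ⟨by linarith [min_le_right ε x], le_rfl⟩, hxW⟩
  have hb3 : 0 ≤ wronskian u₁ v₁ u₂ v₂ b := hb3
  have b0 : 0 < b := by linarith
  have neg : ∀ t ∈ Ioo 0 b, wronskian u₁ v₁ u₂ v₂ t < 0 := fun t ht => by
    by_contra! hc
    rcases lt_or_ge t (min ε x / 2) with h | h
    · exact absurd (hεW ⟨ht.1, by linarith [min_le_left ε x]⟩ : wronskian u₁ v₁ u₂ v₂ t < 0)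
        (not_lt.2 hc)
    · exact absurd (hbmin ⟨⟨h, by linarith [ht.2]⟩, hc⟩) (not_le.2 ht.2)
  have hWb : wronskian u₁ v₁ u₂ v₂ b = 0 := by
    refine le_antisymm ?_ hb3
    have : Tendsto (wronskian u₁ v₁ u₂ v₂) (𝓝[<] b) (𝓝 (wronskian u₁ v₁ u₂ v₂ b)) :=
      Wc.continuousAt.tendsto.mono_left nhdsWithin_le_nhds
    refine le_of_tendsto this ?_
    filter_upwards [Ioo_mem_nhdsLT b0] with t ht using (neg t ht).le
  have hint : interior (Icc 0 b) = Ioo 0 b := interior_Icc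
  have hK := monotoneOn_relativeEnergy hV hp h₁ h₂ p₁ p₂ (convex_Icc 0 b)
    (hint ▸ fun t ht => ht.1) (hint ▸ neg)
  have hq := strictAntiOn_quotient h₁ h₂ p₂ (convex_Icc 0 b) (hint ▸ neg)
  -- At `b` the derivative terms cancel, so the sign of the relative energy is that of u₁ - u₂. As
  -- the quotient decreases, u₁ > u₂ on (0, b); the Wronskian then strictly decreases from a value ≤
  -- 0 and cannot vanish at `b`.
  have hKb : 0 ≤ relativeEnergy V p ω u₁ v₁ u₂ v₂ b :=
    hK0.trans (hK ⟨le_rfl, b0.le⟩ ⟨b0.le, le_rfl⟩ b0.le)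
  have hub : u₂ b ≤ u₁ b := by
    rw [relativeEnergy_eq hp (p₁ b) (p₂ b)] at hKb
    have e : v₁ b = u₁ b / u₂ b * v₂ b := by
      have := (p₂ b).ne'
      rw [wronskian] at hWb
      field_simp
      linarith
    rw [e, mul_pow, sub_self, zero_div, zero_add] at hKb
    by_contra! hlt
    have h3 : u₁ b ^ (p - 1) < u₂ b ^ (p - 1) := Real.rpow_lt_rpow (p₁ b).le hlt (by linarith)
    have h4 : u₁ b ^ 2 * (u₁ b ^ (p - 1) - u₂ b ^ (p - 1)) / (p + 1) < 0 :=
      div_neg_of_neg_of_pos (mul_neg_of_pos_of_neg (pow_pos (p₁ b) 2) (by linarith)) (by linarith)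
    linarith
  have hWanti : StrictAntiOn (wronskian u₁ v₁ u₂ v₂) (Icc 0 b) := by
    refine strictAntiOn_of_deriv_neg (convex_Icc 0 b) Wc.continuousOn fun t ht => ?_
    rw [hint] at ht
    rw [(hasDerivAt_wronskian hV hp h₁ h₂ (p₁ t) (p₂ t) ht.1.ne').deriv]
    refine mul_neg_of_pos_of_neg (mul_pos (p₁ t) (p₂ t)) (sub_neg.2 ?_)
    refine Real.rpow_lt_rpow (p₂ t).le ?_ (by linarith)
    have h3 : u₁ b / u₂ b < u₁ t / u₂ t := hq ⟨ht.1.le, ht.2.le⟩ ⟨b0.le, le_rfl⟩ ht.2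
    exact (one_lt_div (p₂ t)).1 (((one_le_div (p₂ b)).2 hub).trans_lt h3)
  have := hWanti ⟨le_rfl, b0.le⟩ ⟨b0.le, le_rfl⟩ b0
  linarith

theorem false_of_wronskian_neg (hV : PotentialCondition V) (hp : 1 < p)
    (h₁ : IsProfile V p ω u₁ v₁) (h₂ : IsProfile V p ω u₂ v₂) (p₁ : ∀ x, 0 < u₁ x)
    (p₂ : ∀ x, 0 < u₂ x) (hW0 : wronskian u₁ v₁ u₂ v₂ 0 ≤ 0)
    (hK0 : 0 ≤ relativeEnergy V p ω u₁ v₁ u₂ v₂ 0)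
    (hW : ∀ᶠ x in 𝓝[>] 0, wronskian u₁ v₁ u₂ v₂ x < 0) : False := by
  have neg : ∀ x ∈ interior (Ici (0 : ℝ)), wronskian u₁ v₁ u₂ v₂ x < 0 := fun x hx =>
    wronskian_neg hV hp h₁ h₂ p₁ p₂ hW0 hK0 hW (interior_Ici (a := (0 : ℝ)) ▸ hx : x ∈ Ioi 0)
  have hK := monotoneOn_relativeEnergy hV hp h₁ h₂ p₁ p₂ (convex_Ici 0) interior_Ici.le neg
  have hq := strictAntiOn_quotient h₁ h₂ p₂ (convex_Ici 0) neg
  have hlim : Tendsto (relativeEnergy V p ω u₁ v₁ u₂ v₂) atTop (𝓝 0) := by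
    have t1 := tendsto_zero_of_antitoneOn_of_integrable (h₁.antitoneOn_energy hV hp)
      (h₁.integrable_energy hp)
    have t2 := tendsto_zero_of_antitoneOn_of_integrable (h₂.antitoneOn_energy hV hp)
      (h₂.integrable_energy hp)
    -- The quotient decreases, so it is bounded by its value at 0.
    have t3 : Tendsto (fun x => (u₁ x / u₂ x) ^ 2 * energy V p ω u₂ v₂ x) atTop (𝓝 0) := by
      refine squeeze_zero_norm' (a := fun x => (u₁ 0 / u₂ 0) ^ 2 * |energy V p ω u₂ v₂ x|) ?_
        (by simpa using t2.abs.const_mul ((u₁ 0 / u₂ 0) ^ 2))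
      filter_upwards [eventually_ge_atTop 0] with x hx
      have h3 : u₁ x / u₂ x ≤ u₁ 0 / u₂ 0 := hq.antitoneOn (mem_Ici.2 le_rfl) hx hx
      have h4 := div_pos (p₁ x) (p₂ x)
      rw [norm_mul, Real.norm_of_nonneg (sq_nonneg _), Real.norm_eq_abs]
      gcongr
    simpa using! t1.sub t3
  have hzero : ∀ x ∈ Ioi (0 : ℝ), relativeEnergy V p ω u₁ v₁ u₂ v₂ x = 0 := fun x hx => by
    have hx : 0 < x := hx
    refine le_antisymm (ge_of_tendsto hlim ?_) (hK0.trans (hK (mem_Ici.2 le_rfl) hx.le hx.le))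
    filter_upwards [eventually_ge_atTop x] with y hy using hK hx.le (hx.le.trans hy) hy
  -- The derivative of the relative energy is a nonzero factor times the second energy.
  have hJ : ∀ x ∈ Ioi (0 : ℝ), energy V p ω u₂ v₂ x = 0 := fun x hx => by
    have hx' : x ≠ 0 := ne_of_gt hx
    have h3 : relativeEnergy V p ω u₁ v₁ u₂ v₂ =ᶠ[𝓝 x] fun _ => 0 :=
      (isOpen_Ioi.mem_nhds hx |> fun h => mem_of_superset h hzero)
    have h4 := (hasDerivAt_relativeEnergy hV hp h₁ h₂ (p₂ x) hx').unique
      ((hasDerivAt_const x (0 : ℝ)).congr_of_eventuallyEq h3)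
    have h5 : wronskian u₁ v₁ u₂ v₂ x / u₂ x ^ 2 ≠ 0 :=
      div_ne_zero (neg x (by rwa [interior_Ici])).ne (pow_pos (p₂ x) 2).ne'
    have h6 : 2 * (u₁ x / u₂ x) ≠ 0 := mul_ne_zero two_ne_zero (div_pos (p₁ x) (p₂ x)).ne'
    simpa [h5, (p₁ x).ne', (p₂ x).ne'] using (mul_eq_zero.1 (neg_eq_zero.1 h4)).resolve_left
      (mul_ne_zero h6 h5)
  obtain ⟨x, hx, hd⟩ := hV.exists_pos_deriv_ne_zero
  have h3 : energy V p ω u₂ v₂ =ᶠ[𝓝 x] fun _ => 0 :=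
    mem_of_superset (isOpen_Ioi.mem_nhds hx) hJ
  have h4 := (h₂.hasDerivAt_energy hV hp hx.ne').unique
    ((hasDerivAt_const x (0 : ℝ)).congr_of_eventuallyEq h3)
  have h5 : deriv V x * u₂ x ^ 2 = 0 := by linarith
  exact mul_ne_zero hd (pow_pos (p₂ x) 2).ne' h5

end Pair

/-! ### Data at the origin and conclusion. -/

/-- A positive profile does not have negative slope at the origin. -/
theorem IsProfile.deriv_zero_nonneg {V : ℝ → ℝ} (hV : PotentialCondition V) {p ω : ℝ} (hp : 1 < p)
    {u v : ℝ → ℝ} (h : IsProfile V p ω u v) (hu : ∀ x, 0 < u x) : 0 ≤ v 0 := by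
  by_contra! hv
  have h' := h.reflect hV.even
  have hW0 : wronskian u v (fun x => u (-x)) (fun x => -v (-x)) 0 < 0 := by
    simp only [wronskian, neg_zero]
    nlinarith [mul_neg_of_neg_of_pos hv (hu 0)]
  refine false_of_wronskian_neg hV hp h h' hu (fun x => hu _) hW0.le ?_ ?_
  -- A profile and its reflection have the same value and opposite slopes at 0, so their relative
  -- energy vanishes there.
  · rw [relativeEnergy_eq hp (hu 0) (by simpa using hu 0)]
    simp [(hu 0).ne']
  · have Wc : Continuous (wronskian u v (fun x => u (-x)) (fun x => -v (-x))) :=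
      (h.continuous_deriv.mul h'.continuous).sub (h.continuous.mul h'.continuous_deriv)
    exact (Wc.continuousAt.eventually_lt continuousAt_const hW0).filter_mono nhdsWithin_le_nhds

theorem IsProfile.deriv_zero {V : ℝ → ℝ} (hV : PotentialCondition V) {p ω : ℝ} (hp : 1 < p)
    {u v : ℝ → ℝ} (h : IsProfile V p ω u v) (hu : ∀ x, 0 < u x) : v 0 = 0 := by
  have h1 := h.deriv_zero_nonneg hV hp hu
  have h2 := (h.reflect hV.even).deriv_zero_nonneg hV hp fun x => hu _
  rw [neg_zero] at h2
  linarith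

theorem IsProfile.apply_zero_le {V : ℝ → ℝ} (hV : PotentialCondition V) {p ω : ℝ} (hp : 1 < p)
    {u₁ v₁ u₂ v₂ : ℝ → ℝ} (h₁ : IsProfile V p ω u₁ v₁) (h₂ : IsProfile V p ω u₂ v₂)
    (p₁ : ∀ x, 0 < u₁ x) (p₂ : ∀ x, 0 < u₂ x) : u₁ 0 ≤ u₂ 0 := by
  by_contra! hlt
  have d₁ := h₁.deriv_zero hV hp p₁
  have d₂ := h₂.deriv_zero hV hp p₂
  have hW0 : wronskian u₁ v₁ u₂ v₂ 0 = 0 := by simp [wronskian, d₁, d₂]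
  have Wc : Continuous (wronskian u₁ v₁ u₂ v₂) :=
    (h₁.continuous_deriv.mul h₂.continuous).sub (h₁.continuous.mul h₂.continuous_deriv)
  refine false_of_wronskian_neg hV hp h₁ h₂ p₁ p₂ hW0.le ?_ ?_
  · rw [relativeEnergy_eq hp (p₁ 0) (p₂ 0), d₁, d₂]
    have h3 := Real.rpow_le_rpow (p₂ 0).le hlt.le (by linarith : 0 ≤ p - 1)
    have h4 : 0 ≤ u₁ 0 ^ 2 * (u₁ 0 ^ (p - 1) - u₂ 0 ^ (p - 1)) / (p + 1) :=
      div_nonneg (mul_nonneg (sq_nonneg _) (by linarith)) (by linarith)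
    simpa using h4
  · have hev : ∀ᶠ x in 𝓝 (0 : ℝ), u₂ x < u₁ x :=
      h₂.continuous.continuousAt.eventually_lt h₁.continuous.continuousAt hlt
    obtain ⟨ε, hε, hball⟩ := Metric.eventually_nhds_iff.1 hev
    -- The Wronskian vanishes at 0 since both slopes do; its negativity on the right comes from its
    -- derivative, as u₁ > u₂ near 0.
    have hanti : StrictAntiOn (wronskian u₁ v₁ u₂ v₂) (Ico 0 ε) := by
      refine strictAntiOn_of_deriv_neg (convex_Ico 0 ε) Wc.continuousOn fun t ht => ?_
      rw [interior_Ico] at ht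
      rw [(hasDerivAt_wronskian hV hp h₁ h₂ (p₁ t) (p₂ t) ht.1.ne').deriv]
      refine mul_neg_of_pos_of_neg (mul_pos (p₁ t) (p₂ t)) (sub_neg.2 ?_)
      refine Real.rpow_lt_rpow (p₂ t).le (hball ?_) (by linarith)
      rw [dist_zero_right, Real.norm_of_nonneg ht.1.le]
      exact ht.2
    filter_upwards [Ioo_mem_nhdsGT hε] with t ht
    rw [← hW0]
    exact hanti ⟨le_rfl, hε⟩ ⟨ht.1.le, ht.2⟩ ht.1

end NLS1D

theorem theorem4p1 (V : ℝ → ℝ) (hV : NLS1D.PotentialCondition V) (p : ℝ) (hp : 1 < p)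
    (ω : ℝ) (hω : NLS1D.omegaOne V < ω) (φ ψ : ℝ → ℂ)
    (hφ : NLS1D.IsPositiveSolution V p ω φ) (hψ : NLS1D.IsPositiveSolution V p ω ψ) :
    φ =ᵐ[MeasureTheory.volume] ψ := by
  have aux : ∀ χ : ℝ → ℂ, NLS1D.IsPositiveSolution V p ω χ → ∃ u v, NLS1D.IsProfile V p ω u v ∧
      (∀ x, 0 < u x) ∧ χ =ᵐ[MeasureTheory.volume] fun x => (u x : ℂ) := fun χ hχ => by
    obtain ⟨u, v, h, hu⟩ := hχ.exists_isProfile hV hp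
    refine ⟨u, v, h, h.pos hV.locallyIntegrable hp fun h0 => ?_, hu⟩
    obtain ⟨x, hx1, hx2⟩ := (hu.and hχ.2.2).exists
    simp [hx1, h0] at hx2
  obtain ⟨u₁, v₁, h₁, p₁, e₁⟩ := aux φ hφ
  obtain ⟨u₂, v₂, h₂, p₂, e₂⟩ := aux ψ hψ
  have hu : u₁ = u₂ := h₁.eq_of_eq_at hV.locallyIntegrable hp h₂
    (le_antisymm (h₁.apply_zero_le hV hp h₂ p₁ p₂) (h₂.apply_zero_le hV hp h₁ p₂ p₁))
    ((h₁.deriv_zero hV hp p₁).trans (h₂.deriv_zero hV hp p₂).symm)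
  rw [hu] at e₁
  exact e₁.trans e₂.symm
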